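/- A finite-dimensional generalized probabilistic theory (GPT) is a triple $\mathcal A=(A,\Omega_A,E_A)$ consisting of a finite-dimensional real vector space $A$, a convex compact set of effects $E_A\subset A$ spanning $A$, containing a unit effect $u_A\in E_A$ with $u_A-e\in E_A$ for all $e\in E_A$, and a convex compact set of normalized states $\Omega_A\subset A^*$ spanning $A^*$, such that $\omega(u_A)=1$ and $0\le\omega(e)\le 1$ for all $\omega\in\Omega_A$, $e\in E_A$. It is *unrestricted* if $\Omega_A=\{\omega\in A^* : \omega(u_A)=1,\ 0\le\omega(e)\le1\ \forall e\in E_A\}$ and $E_A=\{e\in A : 0\le\omega(e)\le 1\ \forall\omega\in\Omega_A\}$. An *exact embedding* of $\mathcal A$ into a GPT $\mathcal B=(B,\Omega_B,E_B)$ is a pair of linear maps $\Phi:A\to B$, $\Psi:A^*\to B^*$ with $\Phi(E_A)\subseteq E_B$, $\Psi(\Omega_A)\subseteq\Omega_B$ and $\Psi(\omega)(\Phi(e))=\omega(e)$ for all $e\in E_A$, $\omega\in\Omega_A$. Quantum theory $\mathcal Q_n$ has $B=\mathbf H_n(\mathbb C)$ (the complex Hermitian $n\times n$ matrices), $E_B=\{e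 : 0\le e\le \mathbf 1\}$, $u_B=\mathbf 1$, and as states the functionals $x\mapsto\mathrm{tr}(\rho x)$ with $\rho\ge0$, $\mathrm{tr}\,\rho=1$. A *Euclidean Jordan algebra* is a finite-dimensional unital real Jordan algebra $(\mathcal J,\circ)$ with an inner product satisfying $\langle x\circ y,z\rangle=\langle y,x\circ z\rangle$; it is *special* if it embeds, by an injective linear map preserving the product, into $\mathbf H_n(\mathbb C)$ with the product $x\circ y=\frac12(xy+yx)$ for some $n$. Its GPT has unit effect $1_{\mathcal J}$; its states are the functionals $\langle w,\cdot\rangle$ with $w\in\mathcal J_+:=\{x\circ x : x\in\mathcal J\}$ and $\langle w,1_{\mathcal J}\rangle=1$, and its effects are the $e\in\mathcal J_+$ with values in $[0,1]$ on all states. **Theorem.** Let $\mathcal A$ be an unrestricted GPT. Then $\mathcal A$ can be exactly embedded into $\mathcal Q_n$ for some $n$ if and only if $\mathcal A$ is isomorphic to the GPT of a special Euclidean Jordan algebra (i.e. there is a linear isomorphism $A\to\mathcal J$ identifying the effects, the unit effects and the states). -/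

import Mathlib

open scoped ComplexOrder

noncomputable section

/-! ### Generalized probabilistic theories -/

/-- The data of a generalized probabilistic theory on a real vector space `A`: the set of
effects, the unit effect, and the set of normalized states, which are linear functionals on `A`.
The pairing `(ω, e)` of a state with an effect is `ω e`. -/
structure GPTData (A : Type*) [AddCommGroup A] [Module ℝ A] where
  /-- the set `E_A` of effects -/
  effects : Set A
  /-- the unit effect `u_A` -/
  unit : A
  /-- the set `Ω_A` of normalized states -/
  states : Set (Module.Dual ℝ A)

namespace GPTData

variable {A B : Type*} [AddCommGroup A] [Module ℝ A] [AddCommGroup B] [Module ℝ B]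

/-- The axioms of a generalized probabilistic theory. Compactness refers to the canonical topology
of a finite-dimensional real vector space (its module topology). -/
structure IsGPT (𝒜 : GPTData A) : Prop where
  finiteDimensional : FiniteDimensional ℝ A
  convex_effects : Convex ℝ 𝒜.effects
  isCompact_effects : @IsCompact A (moduleTopology ℝ A) 𝒜.effects
  span_effects : Submodule.span ℝ 𝒜.effects = ⊤
  unit_mem : 𝒜.unit ∈ 𝒜.effects
  unit_sub_mem : ∀ e ∈ 𝒜.effects, 𝒜.unit - e ∈ 𝒜.effects
  convex_states : Convex ℝ 𝒜.states
  isCompact_states :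
    @IsCompact (Module.Dual ℝ A) (moduleTopology ℝ (Module.Dual ℝ A)) 𝒜.states
  span_states : Submodule.span ℝ 𝒜.states = ⊤
  apply_unit : ∀ ω ∈ 𝒜.states, ω 𝒜.unit = 1
  apply_mem_Icc : ∀ ω ∈ 𝒜.states, ∀ e ∈ 𝒜.effects, ω e ∈ Set.Icc (0 : ℝ) 1

/-- The no-restriction hypothesis: every normalized functional giving probabilities on all effects
is a state, and every vector to which all states give probabilities is an effect. -/
structure IsUnrestricted (𝒜 : GPTData A) : Prop where
  states_eq : 𝒜.states =
    {ω | ω 𝒜.unit = 1 ∧ ∀ e ∈ 𝒜.effects, ω e ∈ Set.Icc (0 : ℝ) 1}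
  effects_eq : 𝒜.effects = {e | ∀ ω ∈ 𝒜.states, ω e ∈ Set.Icc (0 : ℝ) 1}

/-- A pair of linear maps `Φ` (on effects) and `Ψ` (on states) is an exact embedding of `𝒜` into
`ℬ` if both are positive, `Ψ` preserves normalization, and outcome probabilities are preserved. -/
structure IsExactEmbedding (𝒜 : GPTData A) (ℬ : GPTData B)
    (Φ : A →ₗ[ℝ] B) (Ψ : Module.Dual ℝ A →ₗ[ℝ] Module.Dual ℝ B) : Prop where
  map_effects : ∀ e ∈ 𝒜.effects, Φ e ∈ ℬ.effects
  map_states : ∀ ω ∈ 𝒜.states, Ψ ω ∈ ℬ.states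
  apply_eq : ∀ e ∈ 𝒜.effects, ∀ ω ∈ 𝒜.states, Ψ ω (Φ e) = ω e

/-- `𝒜` can be exactly embedded into `ℬ`. -/
def ExactlyEmbeds (𝒜 : GPTData A) (ℬ : GPTData B) : Prop :=
  ∃ (Φ : A →ₗ[ℝ] B) (Ψ : Module.Dual ℝ A →ₗ[ℝ] Module.Dual ℝ B), 𝒜.IsExactEmbedding ℬ Φ Ψ

/-- `𝒜` and `ℬ` are the same theory up to a linear change of coordinates: a linear isomorphism
identifies the effects, the unit effects, and (by pull-back) the states. -/
def Isomorphic (𝒜 : GPTData A) (ℬ : GPTData B) : Prop :=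
  ∃ f : A ≃ₗ[ℝ] B, f '' 𝒜.effects = ℬ.effects ∧ f 𝒜.unit = ℬ.unit ∧
    𝒜.states = (fun ω : Module.Dual ℝ B => ω ∘ₗ f.toLinearMap) '' ℬ.states

end GPTData

/-! ### Finite-dimensional complex quantum theory -/

/-- The real vector space of complex Hermitian `n × n` matrices. -/
abbrev Herm (n : ℕ) : Type := selfAdjoint (Matrix (Fin n) (Fin n) ℂ)

/-- The Jordan product `(xy + yx) / 2` of Hermitian matrices. -/
def Herm.jordanMul {n : ℕ} (x y : Herm n) : Herm n :=
  ⟨(1 / 2 : ℝ) • ((x : Matrix (Fin n) (Fin n) ℂ) * y + y * x), by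
    rw [selfAdjoint.mem_iff, star_smul, star_add, star_mul, star_mul,
      selfAdjoint.mem_iff.mp x.2, selfAdjoint.mem_iff.mp y.2, star_trivial, add_comm]⟩

/-- `n`-level quantum theory: the effects are the POVM elements `0 ≤ e ≤ 1`, and the states are
the functionals `x ↦ tr (ρ x)` for density matrices `ρ`. -/
def quantumGPT (n : ℕ) : GPTData (Herm n) where
  effects := {e | (e : Matrix (Fin n) (Fin n) ℂ).PosSemidef ∧
    (1 - (e : Matrix (Fin n) (Fin n) ℂ)).PosSemidef}
  unit := 1
  states := {ω | ∃ ρ : Matrix (Fin n) (Fin n) ℂ, ρ.PosSemidef ∧ ρ.trace = 1 ∧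
    ∀ x : Herm n, ((ω x : ℝ) : ℂ) = (ρ * (x : Matrix (Fin n) (Fin n) ℂ)).trace}

/-! ### Euclidean Jordan algebras -/

/-- An inner product on a real algebra for which `⟨x ∘ y, z⟩ = ⟨y, x ∘ z⟩`. On a
finite-dimensional unital Jordan algebra, such a form is a Euclidean structure. -/
structure IsEuclideanForm {J : Type*} [NonAssocCommRing J] [Module ℝ J]
    (β : LinearMap.BilinForm ℝ J) : Prop where
  symm : ∀ x y, β x y = β y x
  pos : ∀ x, x ≠ 0 → 0 < β x x
  assoc : ∀ x y z, β (x * y) z = β y (x * z)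

/-- A real Jordan algebra is special if it embeds into some algebra of complex Hermitian matrices
with the Jordan product `(xy + yx) / 2`. -/
def IsSpecialJordan (J : Type*) [NonAssocCommRing J] [Module ℝ J] : Prop :=
  ∃ (n : ℕ) (φ : J →ₗ[ℝ] Herm n), Function.Injective φ ∧
    ∀ x y, φ (x * y) = Herm.jordanMul (φ x) (φ y)

/-- The cone of squares. -/
def squareCone (J : Type*) [NonAssocCommRing J] : Set J := {x | ∃ y, x = y * y}

/-- The theory of a Euclidean Jordan algebra: the unit effect is the unit element, the states are
the normalized elements of the cone of squares, regarded as functionals through the inner product,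
and the effects are the elements of the cone of squares to which all states give probabilities. -/
def jordanGPT (J : Type*) [NonAssocCommRing J] [Module ℝ J] (β : LinearMap.BilinForm ℝ J) :
    GPTData J where
  effects := {e | e ∈ squareCone J ∧ ∀ w ∈ squareCone J, β w 1 = 1 → β w e ∈ Set.Icc (0 : ℝ) 1}
  unit := 1
  states := {ω | ∃ w ∈ squareCone J, β w 1 = 1 ∧ ω = β w}

/-- `𝒜` is, up to isomorphism, the theory of a special Euclidean Jordan algebra (real,
finite-dimensional and unital). -/
def IsSpecialEuclideanJordanGPT {A : Type*} [AddCommGroup A] [Module ℝ A]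
    (𝒜 : GPTData A) : Prop :=
  ∃ (J : Type) (_ : NonAssocCommRing J) (_ : Module ℝ J) (_ : SMulCommClass ℝ J J)
    (_ : IsScalarTower ℝ J J) (_ : FiniteDimensional ℝ J) (_ : IsCommJordan J)
    (β : LinearMap.BilinForm ℝ J),
    IsEuclideanForm β ∧ IsSpecialJordan J ∧ 𝒜.Isomorphic (jordanGPT J β)

end

open scoped ComplexOrder

noncomputable section

open Matrix

/-! ### Hermitian matrices -/

namespace Herm

variable {n : ℕ}

/-! From an embedding to a Jordan algebra: the transpose `T` of `Ψ` is a left inverse of `Φ`,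
because effects and states span. The no-restriction hypothesis makes `T` send quantum effects to
effects, so `P = Φ ∘ T` is a positive idempotent with `P 1 ≤ 1`. The range of such a projection is a
Jordan algebra for the product `P (x ∘ y)`. Kadison's inequality `P (a²) ≥ (P a)²` and
Cauchy–Schwarz give `T (Φ a ∘ b) = T (Φ a ∘ Φ (T b))` (`map_jordanMul`). Let `s` be the joint
support of density matrices representing a spanning set of states. Then `s` commutes with the range
of `Φ` (`commute`), and after multiplication by `s` the product `P (x ∘ y)` becomes the ordinary `x
∘ y` (`support_mul_map`). So `a ↦ s Φ(a) s` maps `A`, injectively since `T` inverts it, onto a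
genuine Jordan algebra of matrices with unit `s`.

Conversely, the cone of squares of a special algebra is self-dual for every Euclidean form
(`apply_squares_nonneg`, `mem_squareCone`), in particular for the trace form. Representing a state
through the trace form therefore yields a square, whose image is a density matrix. The same
self-duality identifies effects and states in the first direction. -/

lemma isHermitian (x : Herm n) : (x : Matrix (Fin n) (Fin n) ℂ).IsHermitian := x.2

lemma coe_jordanMul (x y : Herm n) : (jordanMul x y : Matrix (Fin n) (Fin n) ℂ) =
    (1 / 2 : ℝ) • ((x : Matrix (Fin n) (Fin n) ℂ) * y + y * x) := rfl

lemma coe_jordanMul_self (x : Herm n) : (jordanMul x x : Matrix (Fin n) (Fin n) ℂ) = x * x := by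
  rw [coe_jordanMul, ← two_smul ℝ, smul_smul]; norm_num

lemma jordanMul_comm (x y : Herm n) : jordanMul x y = jordanMul y x := by
  ext1; rw [coe_jordanMul, coe_jordanMul, add_comm]

/-- The Jordan product as a bilinear map. -/
def jordan (n : ℕ) : Herm n →ₗ[ℝ] Herm n →ₗ[ℝ] Herm n :=
  LinearMap.mk₂ ℝ jordanMul
    (fun x y z => by
      ext1
      simp only [coe_jordanMul, AddSubgroup.coe_add]
      rw [← smul_add]
      noncomm_ring)
    (fun c x y => by
      ext1
      simp only [coe_jordanMul, selfAdjoint.val_smul, smul_mul_assoc, mul_smul_comm,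
        ← smul_add, smul_comm c])
    (fun x y z => by
      ext1
      simp only [coe_jordanMul, AddSubgroup.coe_add]
      rw [← smul_add]
      noncomm_ring)
    (fun c x y => by
      ext1
      simp only [coe_jordanMul, selfAdjoint.val_smul, smul_mul_assoc, mul_smul_comm,
        ← smul_add, smul_comm c])

@[simp] lemma jordan_apply (x y : Herm n) : jordan n x y = jordanMul x y := rfl

lemma posSemidef_mul_self (x : Herm n) :
    ((x : Matrix (Fin n) (Fin n) ℂ) * x).PosSemidef := by
  simpa [x.isHermitian.eq] using posSemidef_conjTranspose_mul_self (x : Matrix (Fin n) (Fin n) ℂ)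

lemma mul_self_eq_zero {x : Herm n} (h : (x : Matrix (Fin n) (Fin n) ℂ) * x = 0) : x = 0 := by
  have := trace_conjTranspose_mul_self_eq_zero_iff (A := (x : Matrix (Fin n) (Fin n) ℂ))
  rw [x.isHermitian.eq, h] at this
  exact Subtype.ext (this.1 (by simp))

/-- The real part of the trace of a product. -/
def traceForm (n : ℕ) : Matrix (Fin n) (Fin n) ℂ →ₗ[ℝ] Matrix (Fin n) (Fin n) ℂ →ₗ[ℝ] ℝ :=
  LinearMap.mk₂ ℝ (fun x y => (x * y).trace.re)
    (fun x y z => by simp [add_mul]) (fun c x y => by simp [trace_smul])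
    (fun x y z => by simp [mul_add]) (fun c x y => by simp [trace_smul])

lemma traceForm_apply (x y : Matrix (Fin n) (Fin n) ℂ) :
    traceForm n x y = (x * y).trace.re := rfl

lemma traceForm_comm (x y : Matrix (Fin n) (Fin n) ℂ) : traceForm n x y = traceForm n y x := by
  rw [traceForm_apply, trace_mul_comm, traceForm_apply]

lemma ofReal_traceForm {x y : Matrix (Fin n) (Fin n) ℂ} (hx : x.IsHermitian) (hy : y.IsHermitian) :
    ((traceForm n x y : ℝ) : ℂ) = (x * y).trace := by
  rw [traceForm_apply, ← Complex.conj_eq_iff_re]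
  have := trace_conjTranspose (x * y)
  rw [conjTranspose_mul, hx.eq, hy.eq, trace_mul_comm] at this
  exact this.symm

end Herm

/-! ### Positive semidefinite matrices: trace pairing and supports -/

namespace Matrix.PosSemidef

variable {n : ℕ} {x y : Matrix (Fin n) (Fin n) ℂ}

lemma exists_mul_self (hx : x.PosSemidef) : ∃ a : Herm n, (a : Matrix (Fin n) (Fin n) ℂ) * a = x := by
  refine ⟨⟨cfc Real.sqrt x, cfc_predicate Real.sqrt x⟩, ?_⟩
  have h := posSemidef_iff_isHermitian_and_spectrum_nonneg.1 hx
  have hs : IsSelfAdjoint x := h.1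
  change cfc Real.sqrt x * cfc Real.sqrt x = x
  rw [← cfc_mul ..]
  conv_rhs => rw [← cfc_id' ℝ x]
  exact cfc_congr fun t ht => Real.mul_self_sqrt (by simpa using h.2 ht)

lemma traceForm_nonneg (hx : x.PosSemidef) (hy : y.PosSemidef) : 0 ≤ Herm.traceForm n x y := by
  obtain ⟨a, rfl⟩ := hx.exists_mul_self
  rw [Herm.traceForm_apply, mul_assoc, trace_mul_comm]
  have := (hy.mul_mul_conjTranspose_same (a : Matrix (Fin n) (Fin n) ℂ)).trace_nonneg
  rw [a.isHermitian.eq] at this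
  exact (Complex.le_def.1 this).1

/-- For `x = a²` and `y = b²`, the trace of `xy` is the squared Hilbert–Schmidt norm of `ab`. -/
lemma mul_eq_zero_of_traceForm (hx : x.PosSemidef) (hy : y.PosSemidef)
    (h : Herm.traceForm n x y = 0) : x * y = 0 := by
  have h' := Herm.ofReal_traceForm hx.1 hy.1
  rw [h] at h'
  obtain ⟨a, rfl⟩ := hx.exists_mul_self
  obtain ⟨b, rfl⟩ := hy.exists_mul_self
  have hab : (a : Matrix (Fin n) (Fin n) ℂ) * b = 0 := by
    rw [← trace_conjTranspose_mul_self_eq_zero_iff, conjTranspose_mul, a.isHermitian.eq,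
      b.isHermitian.eq]
    rw [show (b * a * (a * b) : Matrix (Fin n) (Fin n) ℂ) = b * (a * a * b) by noncomm_ring,
      trace_mul_comm, show (a * a * b * b : Matrix (Fin n) (Fin n) ℂ) = a * a * (b * b) by
        noncomm_ring, ← h', Complex.ofReal_zero]
  rw [show (a * a * (b * b) : Matrix (Fin n) (Fin n) ℂ) = a * (a * b) * b by noncomm_ring, hab]
  simp

/-- The support projection of a positive semidefinite matrix. -/
lemma exists_support (hx : x.PosSemidef) : ∃ s : Herm n,
    (s : Matrix (Fin n) (Fin n) ℂ) * s = s ∧ x * s = x ∧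
      ∀ z, x * z = 0 → (s : Matrix (Fin n) (Fin n) ℂ) * z = 0 := by
  have hs : IsSelfAdjoint x := hx.1
  have hc (f : ℝ → ℝ) : ContinuousOn f (spectrum ℝ x) := x.finite_real_spectrum.continuousOn f
  have hid : cfc (fun t : ℝ => t) x = x := cfc_id' ℝ x
  -- Since `0⁻¹ = 0`, the function `t⁻¹ * t` is the indicator of `t ≠ 0`.
  refine ⟨⟨cfc (fun t : ℝ => t⁻¹ * t) x, cfc_predicate _ x⟩, ?_, ?_, fun z hz => ?_⟩
  · change cfc (fun t : ℝ => t⁻¹ * t) x * cfc (fun t : ℝ => t⁻¹ * t) x = cfc (fun t : ℝ => t⁻¹ * t) x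
    rw [← cfc_mul _ _ _ (hc _) (hc _)]
    congr 1; ext t; by_cases h : t = 0 <;> simp [h]
  · change x * cfc (fun t : ℝ => t⁻¹ * t) x = x
    nth_rw 1 [← hid]
    rw [← cfc_mul _ _ _ (hc _) (hc _)]
    nth_rw 2 [← hid]
    congr 1; ext t; by_cases h : t = 0 <;> simp [h]
  · change cfc (fun t : ℝ => t⁻¹ * t) x * z = 0
    rw [cfc_mul _ _ _ (hc _) (hc _), hid, mul_assoc, hz, mul_zero]

end Matrix.PosSemidef

/-- A Hermitian matrix is a real combination of positive semidefinite matrices `p i` that add up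
to the identity, and its square is the combination with the squared coefficients. -/
lemma Herm.exists_spectral_decomposition {n : ℕ} (a : Herm n) :
    ∃ (c : Fin n → ℝ) (p : Fin n → Herm n), (∀ i, (p i : Matrix (Fin n) (Fin n) ℂ).PosSemidef) ∧
      ∑ i, p i = 1 ∧ ∑ i, c i • p i = a ∧
      ∑ i, (c i * c i) • p i = Herm.jordanMul a a := by
  obtain ⟨U, hU, hU', ha⟩ : ∃ U : Matrix (Fin n) (Fin n) ℂ, star U * U = 1 ∧ U * star U = 1 ∧
      (a : Matrix (Fin n) (Fin n) ℂ) =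
        U * diagonal (fun i => (a.isHermitian.eigenvalues i : ℂ)) * star U :=
    ⟨a.isHermitian.eigenvectorUnitary, Unitary.coe_star_mul_self _, Unitary.coe_mul_star_self _,
      a.isHermitian.spectral_theorem.trans (Unitary.conjStarAlgAut_apply _ _)⟩
  have key (d : Fin n → ℝ) : ∑ i, d i • (U * Matrix.single i i 1 * star U) =
      U * diagonal (fun i => (d i : ℂ)) * star U := by
    have h (i : Fin n) : d i • (U * Matrix.single i i 1 * star U) =
        U * (d i • Matrix.single i i 1) * star U := by rw [mul_smul_comm, smul_mul_assoc]
    simp only [h, ← Finset.sum_mul, ← Finset.mul_sum]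
    rw [← sum_single_eq_diagonal]
    congr 2
    refine Finset.sum_congr rfl fun i _ => ?_
    ext j k; simp [Matrix.single_apply]
  have hpos (i : Fin n) : (U * Matrix.single i i 1 * star U).PosSemidef := by
    refine PosSemidef.mul_mul_conjTranspose_same ?_ _
    rw [← diagonal_single]
    refine posSemidef_diagonal_iff.2 fun j => ?_
    by_cases h : j = i <;> simp [h]
  refine ⟨a.isHermitian.eigenvalues, fun i => ⟨_, (hpos i).1⟩, hpos, ?_, ?_, ?_⟩
  · ext1
    have := key 1
    simp only [Pi.one_apply, one_smul, Complex.ofReal_one, diagonal_one, mul_one, hU'] at this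
    rw [AddSubgroup.val_finsetSum]
    simpa using this
  · ext1
    rw [AddSubgroup.val_finsetSum]
    exact (key _).trans ha.symm
  · ext1
    rw [AddSubgroup.val_finsetSum, Herm.coe_jordanMul_self]
    refine (key _).trans ?_
    conv_rhs => rw [ha]
    simp only [Complex.ofReal_mul]
    rw [← diagonal_mul_diagonal]
    generalize diagonal (fun i => (a.isHermitian.eigenvalues i : ℂ)) = D
    rw [show U * D * star U * (U * D * star U) = U * D * (star U * U) * D * star U by noncomm_ring,
      hU, mul_one, ← mul_assoc]

/-! ### Jordan algebras of Hermitian matrices -/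

/-- An injective homomorphism from a real algebra to the Jordan algebra of Hermitian matrices. -/
structure IsJordanEmbedding {J : Type*} [NonAssocCommRing J] [Module ℝ J] {n : ℕ}
    (φ : J →ₗ[ℝ] Herm n) : Prop where
  injective : Function.Injective φ
  map_mul : ∀ x y, φ (x * y) = Herm.jordanMul (φ x) (φ y)

namespace IsJordanEmbedding

variable {J : Type*} [NonAssocCommRing J] [Module ℝ J] {n : ℕ} {φ : J →ₗ[ℝ] Herm n}

lemma coe_map_mul (h : IsJordanEmbedding φ) (x y : J) :
    (φ (x * y) : Matrix (Fin n) (Fin n) ℂ) =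
      (1 / 2 : ℝ) • ((φ x : Matrix (Fin n) (Fin n) ℂ) * φ y + φ y * φ x) := by
  rw [h.map_mul, Herm.coe_jordanMul]

lemma coe_map_mul_self (h : IsJordanEmbedding φ) (x : J) :
    (φ (x * x) : Matrix (Fin n) (Fin n) ℂ) = φ x * φ x := by
  rw [h.map_mul, Herm.coe_jordanMul_self]

lemma ext (h : IsJordanEmbedding φ) {x y : J}
    (hxy : (φ x : Matrix (Fin n) (Fin n) ℂ) = φ y) : x = y :=
  h.injective (Subtype.ext hxy)

lemma exists_eq_pow_succ (h : IsJordanEmbedding φ) (x : J) (k : ℕ) :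
    ∃ y, (φ y : Matrix (Fin n) (Fin n) ℂ) = (φ x : Matrix (Fin n) (Fin n) ℂ) ^ (k + 1) := by
  induction k with
  | zero => exact ⟨x, by simp⟩
  | succ k ih =>
    obtain ⟨y, hy⟩ := ih
    refine ⟨x * y, ?_⟩
    rw [h.coe_map_mul, hy, ← pow_succ, ← pow_succ', ← two_smul ℝ, smul_smul]
    norm_num

/-- The image of a Jordan embedding is closed under functional calculus with functions that
vanish at `0`. -/
lemma exists_eq_cfc (h : IsJordanEmbedding φ) (x : J) {f : ℝ → ℝ} (hf : f 0 = 0) :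
    ∃ y, (φ y : Matrix (Fin n) (Fin n) ℂ) = cfc f (φ x : Matrix (Fin n) (Fin n) ℂ) := by
  classical
  have hx : IsSelfAdjoint (φ x : Matrix (Fin n) (Fin n) ℂ) := (φ x).2
  -- The extra node `0` forces the interpolating polynomial to have no constant term, which matters
  -- because the image need not contain the identity matrix.
  let t : Finset ℝ := insert 0 (φ x : Matrix (Fin n) (Fin n) ℂ).finite_real_spectrum.toFinset
  let p := Lagrange.interpolate t id f
  have hp {i : ℝ} (hi : i ∈ t) : p.eval i = f i :=
    Lagrange.eval_interpolate_at_node (v := id) f (fun _ _ _ _ h => h) hi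
  have h0 : p.coeff 0 = 0 := by
    rw [Polynomial.coeff_zero_eq_eval_zero, hp (Finset.mem_insert_self _ _), hf]
  choose y hy using h.exists_eq_pow_succ x
  refine ⟨∑ i ∈ Finset.range p.natDegree, p.coeff (i + 1) • y i, ?_⟩
  rw [cfc_congr (g := p.eval) fun i hi => (hp (Finset.mem_insert_of_mem (by simpa using hi))).symm,
    cfc_polynomial p _ hx, Polynomial.aeval_eq_sum_range, Finset.sum_range_succ', h0, zero_smul,
    add_zero, map_sum, AddSubgroup.val_finsetSum]
  refine Finset.sum_congr rfl fun i _ => ?_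
  rw [map_smul, selfAdjoint.val_smul, hy]

/-- The square root vanishes at `0`, so the root of a positive image lies in the image again. -/
lemma mem_squareCone_iff (h : IsJordanEmbedding φ) {x : J} :
    x ∈ squareCone J ↔ (φ x : Matrix (Fin n) (Fin n) ℂ).PosSemidef := by
  constructor
  · rintro ⟨y, rfl⟩
    rw [h.coe_map_mul_self]
    exact (φ y).posSemidef_mul_self
  · intro hx
    have hs := posSemidef_iff_isHermitian_and_spectrum_nonneg.1 hx
    have hsa : IsSelfAdjoint (φ x : Matrix (Fin n) (Fin n) ℂ) := (φ x).2
    obtain ⟨y, hy⟩ := h.exists_eq_cfc x Real.sqrt_zero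
    refine ⟨y, h.ext ?_⟩
    rw [h.coe_map_mul_self, hy, ← cfc_mul ..]
    conv_lhs => rw [← cfc_id' ℝ (φ x : Matrix (Fin n) (Fin n) ℂ)]
    exact cfc_congr fun t ht => (Real.mul_self_sqrt (by simpa using hs.2 ht)).symm

/-- Decomposition of an element as a difference of orthogonal squares. -/
lemma exists_eq_sub (h : IsJordanEmbedding φ) (x : J) :
    ∃ a b : J, x = a * a - b * b ∧ b * (a * a) = 0 := by
  have hx : IsSelfAdjoint (φ x : Matrix (Fin n) (Fin n) ℂ) := (φ x).2
  -- `Real.sqrt` is zero on negative numbers, so `a²` and `b²` are the positive and negative parts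
  -- of `x`.
  obtain ⟨a, ha⟩ := h.exists_eq_cfc x (f := fun t => √t) Real.sqrt_zero
  obtain ⟨b, hb⟩ := h.exists_eq_cfc x (f := fun t => √(-t)) (by simp)
  have hab : (φ a : Matrix (Fin n) (Fin n) ℂ) * φ b = 0 := by
    rw [ha, hb, ← cfc_mul .., ← cfc_const_zero ℝ (φ x : Matrix (Fin n) (Fin n) ℂ)]
    congr 1; ext t
    rcases le_total t 0 with ht | ht
    · simp [Real.sqrt_eq_zero_of_nonpos ht]
    · simp [Real.sqrt_eq_zero_of_nonpos (neg_nonpos.2 ht)]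
  have hba : (φ b : Matrix (Fin n) (Fin n) ℂ) * φ a = 0 := by
    have := congrArg conjTranspose hab
    rwa [conjTranspose_mul, (φ a).isHermitian.eq, (φ b).isHermitian.eq, conjTranspose_zero] at this
  refine ⟨a, b, h.ext ?_, h.ext ?_⟩
  · rw [map_sub, AddSubgroupClass.coe_sub, h.coe_map_mul_self, h.coe_map_mul_self, ha, hb,
      ← cfc_mul .., ← cfc_mul .., ← cfc_sub ..]
    conv_lhs => rw [← cfc_id' ℝ (φ x : Matrix (Fin n) (Fin n) ℂ)]
    congr 1; ext t
    rcases le_total t 0 with ht | ht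
    · rw [Real.sqrt_eq_zero_of_nonpos ht, Real.mul_self_sqrt (neg_nonneg.2 ht)]; ring
    · rw [Real.sqrt_eq_zero_of_nonpos (neg_nonpos.2 ht), Real.mul_self_sqrt ht]; ring
  · rw [h.coe_map_mul, h.coe_map_mul_self, ← mul_assoc, hba, mul_assoc, hab]
    simp

/-- The image `p` of the unit is only a projection. Multiplying `2y = py + yp` by `p` on either side
gives `py = pyp = yp`, hence `y = py`. -/
lemma map_one_mul (h : IsJordanEmbedding φ) (x : J) :
    (φ 1 : Matrix (Fin n) (Fin n) ℂ) * φ x = φ x := by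
  have h1 : (φ 1 : Matrix (Fin n) (Fin n) ℂ) * φ 1 = φ 1 := by
    rw [← h.coe_map_mul_self, one_mul]
  have h2 := h.coe_map_mul 1 x
  rw [one_mul] at h2
  have h3 : (2 : ℝ) • (φ x : Matrix (Fin n) (Fin n) ℂ) = φ 1 * φ x + φ x * φ 1 := by
    nth_rw 1 [h2]
    rw [smul_smul]; norm_num
  generalize (φ 1 : Matrix (Fin n) (Fin n) ℂ) = p at *
  generalize (φ x : Matrix (Fin n) (Fin n) ℂ) = y at *
  rw [two_smul] at h3
  have h4 : p * y = p * y * p := by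
    have := congrArg (p * ·) h3
    simp only [mul_add, ← mul_assoc, h1] at this
    exact add_left_cancel this
  have h5 : y * p = p * y * p := by
    have := congrArg (· * p) h3
    simp only [add_mul, mul_assoc, h1] at this
    rw [mul_assoc]
    exact add_right_cancel this
  rw [h5, ← h4, ← two_smul ℝ, ← two_smul ℝ] at h3
  exact (smul_right_injective _ (two_ne_zero (α := ℝ)) h3).symm

lemma posSemidef_one_sub_map_one (h : IsJordanEmbedding φ) :
    (1 - (φ 1 : Matrix (Fin n) (Fin n) ℂ)).PosSemidef := by
  have h1 := h.map_one_mul 1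
  have := (1 - φ 1).posSemidef_mul_self
  have h2 : (1 - (φ 1 : Matrix (Fin n) (Fin n) ℂ)) * (1 - φ 1) = 1 - φ 1 := by
    rw [sub_mul, mul_sub, mul_sub, h1]; simp
  simpa [h2] using this

end IsJordanEmbedding

/-! ### Self-duality of the cone of squares -/

namespace IsEuclideanForm

variable {J : Type*} [NonAssocCommRing J] [Module ℝ J] {β : LinearMap.BilinForm ℝ J} {n : ℕ}
  {φ : J →ₗ[ℝ] Herm n}

lemma self_nonneg (hβ : IsEuclideanForm β) (x : J) : 0 ≤ β x x := by
  by_cases h : x = 0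
  · simp [h]
  · exact (hβ.pos x h).le

lemma eq_zero_of_self_nonpos (hβ : IsEuclideanForm β) {x : J} (h : β x x ≤ 0) : x = 0 := by
  by_contra hx
  exact (hβ.pos x hx).not_ge h

lemma nondegenerate (hβ : IsEuclideanForm β) : β.Nondegenerate :=
  ⟨fun x hx => hβ.eq_zero_of_self_nonpos (hx x).le, fun x hx => hβ.eq_zero_of_self_nonpos (hx x).le⟩

/-- The form is nonnegative on pairs of squares. -/
lemma apply_squares_nonneg (hβ : IsEuclideanForm β) (hφ : IsJordanEmbedding φ) (y z : J) :
    0 ≤ β (y * y) (z * z) := by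
  -- The quadratic representation of `z`: it is self-adjoint for `β`, sends `1` to `z²`, and becomes
  -- `x ↦ zxz` on matrices, so it preserves squares. Moving it across `β` reduces the claim to `β s
  -- s ≥ 0`.
  let U (x : J) : J := (2 : ℝ) • (z * (z * x)) - z * z * x
  have hU (x w : J) : β (U x) w = β x (U w) := by
    simp only [U, map_sub, map_smul, LinearMap.sub_apply, LinearMap.smul_apply, hβ.assoc]
  have hU1 : U 1 = z * z := by
    simp only [U, mul_one]
    rw [two_smul, add_sub_cancel_right]
  have hsq : U (y * y) ∈ squareCone J := by
    rw [hφ.mem_squareCone_iff]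
    have : (φ (U (y * y)) : Matrix (Fin n) (Fin n) ℂ) = φ z * (φ y * φ y) * φ z := by
      simp only [U, map_sub, map_smul, AddSubgroupClass.coe_sub, selfAdjoint.val_smul,
        hφ.coe_map_mul_self, hφ.coe_map_mul z, hφ.coe_map_mul (z * z), smul_add, mul_add, add_mul,
        mul_smul_comm, smul_mul_assoc, smul_smul, mul_assoc]
      norm_num
      module
    rw [this]
    have h := (φ y).posSemidef_mul_self.mul_mul_conjTranspose_same
      (φ z : Matrix (Fin n) (Fin n) ℂ)
    rwa [(φ z).isHermitian.eq] at h
  obtain ⟨s, hs⟩ := hsq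
  rw [← hU1, ← hU, hs, hβ.assoc, mul_one]
  exact hβ.self_nonneg s

/-- Self-duality of the cone of squares. -/
lemma mem_squareCone (hβ : IsEuclideanForm β) (hφ : IsJordanEmbedding φ) {x : J}
    (hx : ∀ y, 0 ≤ β (y * y) x) : x ∈ squareCone J := by
  obtain ⟨a, b, rfl, hab⟩ := hφ.exists_eq_sub x
  -- Orthogonality leaves only `-β (b²) (b²)`, which forces the negative part to vanish.
  have h := hx b
  rw [map_sub, hβ.assoc b, hab, map_zero, zero_sub, neg_nonneg] at h
  rw [hβ.eq_zero_of_self_nonpos h, sub_zero]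
  exact ⟨a, rfl⟩

/-- Every nonzero square becomes a state after division by `β (y²) 1 = β y y`, so the upper bound on
states says that `1 - e` is nonnegative on all squares; self-duality then applies. -/
lemma mem_effects_iff [SMulCommClass ℝ J J] [IsScalarTower ℝ J J] (hβ : IsEuclideanForm β)
    (hφ : IsJordanEmbedding φ) {e : J} :
    e ∈ (jordanGPT J β).effects ↔ e ∈ squareCone J ∧ 1 - e ∈ squareCone J := by
  constructor
  · rintro ⟨he, h⟩
    refine ⟨he, hβ.mem_squareCone hφ fun y => ?_⟩
    by_cases hy : y = 0
    · simp [hy]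
    have hpos := hβ.pos y hy
    have h1 : β (y * y) 1 = β y y := by rw [hβ.assoc, mul_one]
    have := (h ((β y y)⁻¹ • (y * y)) ⟨(√(β y y))⁻¹ • y, by
      rw [smul_mul_smul_comm, ← mul_inv, Real.mul_self_sqrt hpos.le]⟩ (by
      rw [map_smul, LinearMap.smul_apply, h1, smul_eq_mul, inv_mul_cancel₀ hpos.ne'])).2
    rw [map_smul, LinearMap.smul_apply, smul_eq_mul, inv_mul_le_one₀ hpos] at this
    rw [map_sub, h1]
    linarith
  · rintro ⟨he, y, hy⟩
    refine ⟨he, ?_⟩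
    rintro _ ⟨w, rfl⟩ hw
    obtain ⟨z, rfl⟩ := he
    refine ⟨hβ.apply_squares_nonneg hφ w z, ?_⟩
    have := hβ.apply_squares_nonneg hφ w y
    rw [← hy, map_sub, hw] at this
    linarith

end IsEuclideanForm

/-! ### Embedding a special Euclidean Jordan theory -/

/-- The trace form pulled back along a linear map to Hermitian matrices. -/
def Herm.pullbackTraceForm {V : Type*} [AddCommGroup V] [Module ℝ V] {n : ℕ}
    (φ : V →ₗ[ℝ] Herm n) : LinearMap.BilinForm ℝ V :=
  (Herm.traceForm n).compl₁₂ ((selfAdjoint.submodule ℝ _).subtype ∘ₗ φ)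
    ((selfAdjoint.submodule ℝ _).subtype ∘ₗ φ)

lemma Herm.pullbackTraceForm_apply {V : Type*} [AddCommGroup V] [Module ℝ V] {n : ℕ}
    (φ : V →ₗ[ℝ] Herm n) (x y : V) :
    Herm.pullbackTraceForm φ x y = Herm.traceForm n (φ x) (φ y) := rfl

/-- The trace form is a Euclidean form on every Jordan algebra of Hermitian matrices. -/
lemma IsJordanEmbedding.isEuclideanForm {J : Type*} [NonAssocCommRing J] [Module ℝ J] {n : ℕ}
    {φ : J →ₗ[ℝ] Herm n} (h : IsJordanEmbedding φ) :
    IsEuclideanForm (Herm.pullbackTraceForm φ) where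
  symm x y := Herm.traceForm_comm _ _
  pos x hx := by
    rw [Herm.pullbackTraceForm_apply]
    refine lt_of_le_of_ne ?_ fun h0 => hx (h.injective ?_)
    · exact (Complex.le_def.1 (φ x).posSemidef_mul_self.trace_nonneg).1
    · have h1 := Herm.ofReal_traceForm (φ x).isHermitian (φ x).isHermitian
      rw [← h0, Complex.ofReal_zero] at h1
      rw [map_zero]
      exact Herm.mul_self_eq_zero ((φ x).posSemidef_mul_self.trace_eq_zero_iff.1 h1.symm)
  assoc x y z := by
    simp only [Herm.pullbackTraceForm_apply, h.coe_map_mul, map_smul, LinearMap.smul_apply,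
      map_add, LinearMap.add_apply, Herm.traceForm_apply]
    rw [mul_assoc (φ x : Matrix (Fin n) (Fin n) ℂ), trace_mul_comm (φ x : Matrix (Fin n) (Fin n) ℂ),
      mul_assoc, mul_assoc, add_comm]

/-- The functional `x ↦ tr (r x)` on Hermitian matrices. -/
def Herm.traceDual {n : ℕ} (r : Herm n) : Module.Dual ℝ (Herm n) :=
  Herm.traceForm n r ∘ₗ (selfAdjoint.submodule ℝ _).subtype

lemma Herm.traceDual_apply {n : ℕ} (r x : Herm n) : r.traceDual x = Herm.traceForm n r x := rfl

/-- The trace functional as a linear map in the density matrix. -/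
def Herm.traceDualHom (n : ℕ) : Herm n →ₗ[ℝ] Module.Dual ℝ (Herm n) where
  toFun := Herm.traceDual
  map_add' x y := by ext z; simp [Herm.traceDual_apply]
  map_smul' c x := by ext z; simp [Herm.traceDual_apply]

lemma Herm.traceDual_mem_states {n : ℕ} {r : Herm n}
    (hr : (r : Matrix (Fin n) (Fin n) ℂ).PosSemidef) (h1 : r.traceDual 1 = 1) :
    r.traceDual ∈ (quantumGPT n).states := by
  have h (x : Herm n) := Herm.ofReal_traceForm r.isHermitian x.isHermitian
  refine ⟨r, hr, ?_, fun x => h x⟩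
  have := h 1
  rw [← Herm.traceDual_apply, h1] at this
  simpa using this.symm

/-- The theory of a special Euclidean Jordan algebra embeds into quantum theory. -/
theorem IsSpecialEuclideanJordanGPT.exactlyEmbeds {A : Type*} [AddCommGroup A] [Module ℝ A]
    {𝒜 : GPTData A} (h𝒜 : IsSpecialEuclideanJordanGPT 𝒜) :
    ∃ n : ℕ, 𝒜.ExactlyEmbeds (quantumGPT n) := by
  obtain ⟨J, _, _, _, _, _, _, β, hβ, ⟨n, φ, hφi, hφm⟩, f, hfe, hfu, hfs⟩ := h𝒜
  have hφ : IsJordanEmbedding φ := ⟨hφi, hφm⟩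
  have hτ := hφ.isEuclideanForm
  let R := LinearMap.BilinForm.toDual _ hτ.nondegenerate
  have hR (ω : Module.Dual ℝ J) (x : J) : Herm.traceForm n (φ (R.symm ω)) (φ x) = ω x :=
    LinearMap.BilinForm.apply_toDual_symm_apply (hB := hτ.nondegenerate) ω x
  let Ψ : Module.Dual ℝ A →ₗ[ℝ] Module.Dual ℝ (Herm n) :=
    Herm.traceDualHom n ∘ₗ φ ∘ₗ R.symm.toLinearMap ∘ₗ f.symm.toLinearMap.dualMap
  have hΨ (ω : Module.Dual ℝ J) : Ψ (ω ∘ₗ f.toLinearMap) = (φ (R.symm ω)).traceDual := by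
    have : f.symm.toLinearMap.dualMap (ω ∘ₗ f.toLinearMap) = ω := by ext x; simp
    change Herm.traceDual (φ (R.symm (f.symm.toLinearMap.dualMap (ω ∘ₗ f.toLinearMap)))) = _
    rw [this]
  refine ⟨n, φ ∘ₗ f.toLinearMap, Ψ, ?_, ?_, ?_⟩
  · intro e he
    have := hfe ▸ Set.mem_image_of_mem f he
    obtain ⟨h1, h2⟩ := (hβ.mem_effects_iff hφ).1 this
    refine ⟨hφ.mem_squareCone_iff.1 h1, ?_⟩
    -- As `φ 1` may differ from the identity, `1 - φ e` is split as `(1 - φ 1) + φ (1 - e)`.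
    have := hφ.posSemidef_one_sub_map_one.add (hφ.mem_squareCone_iff.1 h2)
    simpa using this
  · intro ω hω
    rw [hfs] at hω
    obtain ⟨_, ⟨w, ⟨v, rfl⟩, hw1, rfl⟩, rfl⟩ := hω
    simp only [hΨ]
    refine Herm.traceDual_mem_states ?_ ?_
    · refine hφ.mem_squareCone_iff.1 (hτ.mem_squareCone hφ fun y => ?_)
      rw [hτ.symm]
      refine (hβ.apply_squares_nonneg hφ v y).trans_eq ?_
      exact (hR _ _).symm
    · rw [← hw1, ← hR, Herm.traceDual_apply, Herm.traceForm_comm,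
        Herm.traceForm_comm _ (φ 1 : Matrix (Fin n) (Fin n) ℂ), Herm.traceForm_apply,
        Herm.traceForm_apply, hφ.map_one_mul]
      simp
  · intro e _ ω hω
    rw [hfs] at hω
    obtain ⟨ω, _, rfl⟩ := hω
    simp only [hΨ]
    exact hR _ _

/-! ### Positive contractive projections -/

lemma Herm.one_sub_posSemidef {n : ℕ} {s : Herm n}
    (hs : (s : Matrix (Fin n) (Fin n) ℂ) * s = s) :
    ((1 - s : Herm n) : Matrix (Fin n) (Fin n) ℂ).PosSemidef := by
  have h2 : (1 - (s : Matrix (Fin n) (Fin n) ℂ)) * (1 - s) = 1 - s := by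
    rw [sub_mul, mul_sub, mul_sub, hs]; simp
  have := (1 - s).posSemidef_mul_self
  simpa [h2] using this

/-- Kadison's inequality for positive maps with `P 1 ≤ 1`. -/
lemma Herm.kadison {n : ℕ} {P : Herm n →ₗ[ℝ] Herm n}
    (hP : ∀ x ∈ (quantumGPT n).effects, (P x : Matrix (Fin n) (Fin n) ℂ).PosSemidef)
    (h1 : (1 - (P 1 : Matrix (Fin n) (Fin n) ℂ)).PosSemidef) (a : Herm n) :
    ((P (jordanMul a a) - jordanMul (P a) (P a) : Herm n) :
      Matrix (Fin n) (Fin n) ℂ).PosSemidef := by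
  obtain ⟨c, p, hp, hp1, hpa, hpaa⟩ := a.exists_spectral_decomposition
  have hb (i : Fin n) : (P (p i) : Matrix (Fin n) (Fin n) ℂ).PosSemidef := by
    refine hP _ ⟨hp i, ?_⟩
    have h := posSemidef_sum (x := fun j => (p j : Matrix (Fin n) (Fin n) ℂ))
      (Finset.univ.erase i) fun j _ => hp j
    have h2 := congrArg (Subtype.val) hp1
    rw [AddSubgroup.val_finsetSum, ← Finset.add_sum_erase _ _ (Finset.mem_univ i)] at h2
    rw [selfAdjoint.val_one] at h2
    rwa [← h2, add_sub_cancel_left]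
  have hB : (P 1 : Matrix (Fin n) (Fin n) ℂ) = ∑ i, (P (p i) : Matrix (Fin n) (Fin n) ℂ) := by
    rw [← hp1, map_sum, AddSubgroup.val_finsetSum]
  have hC : (P a : Matrix (Fin n) (Fin n) ℂ) = ∑ i, c i • (P (p i) : Matrix (Fin n) (Fin n) ℂ) := by
    rw [← hpa, map_sum, AddSubgroup.val_finsetSum]
    simp
  have hD : (P (jordanMul a a) : Matrix (Fin n) (Fin n) ℂ) =
      ∑ i, (c i * c i) • (P (p i) : Matrix (Fin n) (Fin n) ℂ) := by
    rw [← hpaa, map_sum, AddSubgroup.val_finsetSum]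
    simp only [map_smul, selfAdjoint.val_smul]
  rw [AddSubgroupClass.coe_sub, coe_jordanMul_self, hD]
  have hCh := (P a).isHermitian
  generalize (P a : Matrix (Fin n) (Fin n) ℂ) = C at *
  -- With `bᵢ = P pᵢ` and `C = P a`, the identity behind the inequality is `P (a²) - C² = ∑ (cᵢ - C)
  -- bᵢ (cᵢ - C) + C (1 - P 1) C`.
  have hQ := posSemidef_sum Finset.univ fun i (_ : i ∈ Finset.univ) =>
    (hb i).mul_mul_conjTranspose_same (c i • 1 - C)
  have hR := h1.mul_mul_conjTranspose_same C
  have hsum := hQ.add hR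
  have hterm (i : Fin n) : (c i • 1 - C) * (P (p i) : Matrix (Fin n) (Fin n) ℂ) *
      (c i • 1 - C)ᴴ = (c i * c i) • (P (p i) : Matrix (Fin n) (Fin n) ℂ) -
        C * (c i • (P (p i) : Matrix (Fin n) (Fin n) ℂ)) -
        (c i • (P (p i) : Matrix (Fin n) (Fin n) ℂ)) * C +
        C * (P (p i) : Matrix (Fin n) (Fin n) ℂ) * C := by
    rw [conjTranspose_sub, conjTranspose_smul, conjTranspose_one, hCh.eq, star_trivial]
    simp only [sub_mul, mul_sub, smul_mul_assoc, mul_smul_comm, one_mul, mul_one, smul_sub, smul_smul]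
    abel
  simp only [hterm, Finset.sum_add_distrib, Finset.sum_sub_distrib, ← Finset.mul_sum,
    ← Finset.sum_mul, ← hB, ← hC, hCh.eq] at hsum
  convert hsum using 1
  noncomm_ring

/-- Linear maps `Φ` and `T` between a real vector space and the Hermitian matrices such that
`T ∘ Φ` is the identity, `Φ ∘ T` is a positive contraction, and `T` is represented by finitely
many density matrices. -/
structure IsPositiveRetraction {A : Type*} [AddCommGroup A] [Module ℝ A] {n : ℕ} {ι : Type*}
    (Φ : A →ₗ[ℝ] Herm n) (T : Herm n →ₗ[ℝ] A) (f : ι → Module.Dual ℝ A) (ρ : ι → Herm n) :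
    Prop where
  leftInverse : ∀ a, T (Φ a) = a
  posSemidef_map : ∀ x ∈ (quantumGPT n).effects, (Φ (T x) : Matrix (Fin n) (Fin n) ℂ).PosSemidef
  posSemidef_one_sub : (1 - (Φ (T 1) : Matrix (Fin n) (Fin n) ℂ)).PosSemidef
  separating : ∀ a, (∀ i, f i a = 0) → a = 0
  apply_map : ∀ i x, f i (T x) = Herm.traceForm n (ρ i) x
  posSemidef_density : ∀ i, (ρ i : Matrix (Fin n) (Fin n) ℂ).PosSemidef

namespace IsPositiveRetraction

variable {A : Type*} [AddCommGroup A] [Module ℝ A] {n : ℕ} {ι : Type*}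
  {Φ : A →ₗ[ℝ] Herm n} {T : Herm n →ₗ[ℝ] A} {f : ι → Module.Dual ℝ A} {ρ : ι → Herm n}

lemma map_eq_zero (h : IsPositiveRetraction Φ T f ρ) {x : Herm n}
    (hx : ∀ i, Herm.traceForm n (ρ i) x = 0) : T x = 0 :=
  h.separating _ fun i => (h.apply_map i x).trans (hx i)

lemma kadison (h : IsPositiveRetraction Φ T f ρ) (a : Herm n) :
    ((Φ (T (Herm.jordanMul a a)) - Herm.jordanMul (Φ (T a)) (Φ (T a)) : Herm n) :
      Matrix (Fin n) (Fin n) ℂ).PosSemidef :=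
  Herm.kadison (P := Φ ∘ₗ T) h.posSemidef_map h.posSemidef_one_sub a

/-- The conditional expectation property of a positive contractive projection. -/
lemma map_jordanMul (h : IsPositiveRetraction Φ T f ρ) (a : A) (b : Herm n) :
    T (Herm.jordanMul (Φ a) b) = T (Herm.jordanMul (Φ a) (Φ (T b))) := by
  rw [← sub_eq_zero]
  refine h.separating _ fun i => ?_
  -- The defect in Kadison's inequality, paired with the `i`-th functional, is a positive
  -- semidefinite form. It vanishes at `Φ a`, so by Cauchy–Schwarz `Φ a` lies in its radical.
  let B : LinearMap.BilinForm ℝ (Herm n) := (Herm.jordan n).compr₂ (f i ∘ₗ T) -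
    ((Herm.jordan n).compl₁₂ (Φ ∘ₗ T) (Φ ∘ₗ T)).compr₂ (f i ∘ₗ T)
  have hB (x y : Herm n) : B x y = f i (T (Herm.jordanMul x y) -
      T (Herm.jordanMul (Φ (T x)) (Φ (T y)))) := by
    rw [map_sub]; rfl
  have hnonneg (y : Herm n) : 0 ≤ B y y := by
    rw [hB, ← h.leftInverse (T (Herm.jordanMul y y)), ← map_sub, h.apply_map]
    exact (h.posSemidef_density i).traceForm_nonneg (h.kadison y)
  have hsymm (x y : Herm n) : B x y = B y x := by
    rw [hB, hB, Herm.jordanMul_comm, Herm.jordanMul_comm (Φ (T x))]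
  have h0 : B (Φ a) (Φ a) = 0 := by
    rw [hB, h.leftInverse, sub_self, map_zero]
  have hCS := LinearMap.BilinForm.apply_mul_apply_le_of_forall_zero_le B hnonneg (Φ a) b
  rw [h0, zero_mul, hsymm b, ← pow_two] at hCS
  have := pow_eq_zero_iff (two_ne_zero) |>.1 (le_antisymm hCS (sq_nonneg _))
  rwa [hB, h.leftInverse] at this

/-- The projection onto the joint support of the density matrices. -/
lemma exists_support [Finite ι] (h : IsPositiveRetraction Φ T f ρ) : ∃ s : Herm n,
    (s : Matrix (Fin n) (Fin n) ℂ) * s = s ∧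
    (∀ i, (ρ i : Matrix (Fin n) (Fin n) ℂ) * s = ρ i) ∧
    ∀ x : Herm n, (x : Matrix (Fin n) (Fin n) ℂ).PosSemidef → T x = 0 →
      (s : Matrix (Fin n) (Fin n) ℂ) * x = 0 := by
  have := Fintype.ofFinite ι
  obtain ⟨s, hss, hrs, hs⟩ := (posSemidef_sum (x := fun i => (ρ i : Matrix (Fin n) (Fin n) ℂ))
    Finset.univ fun i _ => h.posSemidef_density i).exists_support
  have hq := Herm.one_sub_posSemidef hss
  refine ⟨s, hss, fun i => ?_, fun x hx hTx => hs _ ?_⟩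
  · have h1 : ∑ i, Herm.traceForm n (ρ i) (1 - s : Herm n) = 0 := by
      have h2 : (∑ i, (ρ i : Matrix (Fin n) (Fin n) ℂ)) * (1 - s : Herm n) = 0 := by
        rw [AddSubgroupClass.coe_sub, mul_sub, hrs, selfAdjoint.val_one, mul_one, sub_self]
      rw [← LinearMap.sum_apply, ← map_sum, Herm.traceForm_apply, h2]
      simp
    have h2 := (Finset.sum_eq_zero_iff_of_nonneg fun i _ =>
      (h.posSemidef_density i).traceForm_nonneg hq).1 h1 i (Finset.mem_univ i)
    have h3 := (h.posSemidef_density i).mul_eq_zero_of_traceForm hq h2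
    rw [AddSubgroupClass.coe_sub, mul_sub, selfAdjoint.val_one, mul_one, sub_eq_zero] at h3
    exact h3.symm
  · rw [Finset.sum_mul]
    refine Finset.sum_eq_zero fun i _ => ?_
    refine (h.posSemidef_density i).mul_eq_zero_of_traceForm hx ?_
    rw [← h.apply_map, hTx, map_zero]

end IsPositiveRetraction

/-- Compression by a Hermitian matrix. -/
def Herm.compress {n : ℕ} (s : Herm n) : Herm n →ₗ[ℝ] Herm n where
  toFun x := ⟨s * x * s, by
    rw [selfAdjoint.mem_iff, star_mul, star_mul, selfAdjoint.mem_iff.mp x.2,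
      selfAdjoint.mem_iff.mp s.2, mul_assoc]⟩
  map_add' x y := by ext1; simp [mul_add, add_mul]
  map_smul' c x := by ext1; simp

lemma Herm.coe_compress {n : ℕ} (s x : Herm n) :
    (s.compress x : Matrix (Fin n) (Fin n) ℂ) = s * x * s := rfl

/-- This reduces a triple product to Jordan products, the only ones that `map_jordanMul` controls.
-/
lemma Herm.compress_eq {n : ℕ} (x y : Herm n) : x.compress y =
    (2 : ℝ) • jordanMul x (jordanMul x y) - jordanMul y (jordanMul x x) := by
  ext1
  simp only [coe_compress, coe_jordanMul, AddSubgroupClass.coe_sub, selfAdjoint.val_smul, smul_add,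
    mul_add, add_mul, mul_smul_comm, smul_mul_assoc, smul_smul, mul_assoc]
  norm_num
  module

namespace IsPositiveRetraction

variable {A : Type*} [AddCommGroup A] [Module ℝ A] {n : ℕ} {ι : Type*}
  {Φ : A →ₗ[ℝ] Herm n} {T : Herm n →ₗ[ℝ] A} {f : ι → Module.Dual ℝ A} {ρ : ι → Herm n}
  {s : Herm n}

lemma density_comm (hs : ∀ i, (ρ i : Matrix (Fin n) (Fin n) ℂ) * s = ρ i) (i : ι) :
    (s : Matrix (Fin n) (Fin n) ℂ) * ρ i = ρ i := by
  have := congrArg conjTranspose (hs i)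
  rwa [conjTranspose_mul, (ρ i).isHermitian.eq, s.isHermitian.eq] at this

lemma map_compress (h : IsPositiveRetraction Φ T f ρ)
    (hs : ∀ i, (ρ i : Matrix (Fin n) (Fin n) ℂ) * s = ρ i) (x : Herm n) :
    T (s.compress x) = T x := by
  rw [← sub_eq_zero, ← map_sub]
  refine h.map_eq_zero fun i => ?_
  rw [AddSubgroupClass.coe_sub, map_sub, sub_eq_zero, Herm.traceForm_apply, Herm.traceForm_apply,
    Herm.coe_compress, ← mul_assoc, ← mul_assoc, hs, trace_mul_comm, ← mul_assoc,
    density_comm hs]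

lemma map_jordanMul_one_sub (h : IsPositiveRetraction Φ T f ρ)
    (hs : ∀ i, (ρ i : Matrix (Fin n) (Fin n) ℂ) * s = ρ i) (x : Herm n) :
    T (Herm.jordanMul (1 - s) x) = 0 := by
  refine h.map_eq_zero fun i => ?_
  have h1 : (ρ i : Matrix (Fin n) (Fin n) ℂ) * (1 - s : Herm n) = 0 := by
    rw [AddSubgroupClass.coe_sub, mul_sub, hs, selfAdjoint.val_one, mul_one, sub_self]
  have h2 : ((1 - s : Herm n) : Matrix (Fin n) (Fin n) ℂ) * ρ i = 0 := by
    rw [AddSubgroupClass.coe_sub, sub_mul, density_comm hs, selfAdjoint.val_one, one_mul, sub_self]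
  rw [Herm.coe_jordanMul, map_smul, map_add, Herm.traceForm_apply, Herm.traceForm_apply,
    ← mul_assoc, h1, zero_mul, ← mul_assoc, trace_mul_comm, ← mul_assoc, h2]
  simp

/-- Put `x = Φ a` and `q = 1 - s`. As `T` kills `q ∘ y` for every `y`, it kills `xqx` and hence
`sxqxs = m* m` with `m = qxs`. Faithfulness on the support gives `m = 0`, so `xs = sxs` is
Hermitian. -/
lemma commute (h : IsPositiveRetraction Φ T f ρ) (hss : (s : Matrix (Fin n) (Fin n) ℂ) * s = s)
    (hs : ∀ i, (ρ i : Matrix (Fin n) (Fin n) ℂ) * s = ρ i)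
    (hfaithful : ∀ x : Herm n, (x : Matrix (Fin n) (Fin n) ℂ).PosSemidef → T x = 0 →
      (s : Matrix (Fin n) (Fin n) ℂ) * x = 0) (a : A) :
    (s : Matrix (Fin n) (Fin n) ℂ) * Φ a = Φ a * s := by
  have h0 : T ((Φ a).compress (1 - s)) = 0 := by
    rw [Herm.compress_eq, map_sub, map_smul, h.map_jordanMul, Herm.jordanMul_comm (Φ a) (1 - s),
      h.map_jordanMul_one_sub hs, h.map_jordanMul_one_sub hs, ← Herm.jordan_apply (Φ a),
      map_zero, map_zero, map_zero, smul_zero, sub_zero]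
  obtain ⟨m, hm⟩ : ∃ m : Matrix (Fin n) (Fin n) ℂ,
    m = (1 - (s : Matrix (Fin n) (Fin n) ℂ)) * Φ a * s := ⟨_, rfl⟩
  have h1 : (s.compress ((Φ a).compress (1 - s)) : Matrix (Fin n) (Fin n) ℂ) =
      m.conjTranspose * m := by
    rw [hm, conjTranspose_mul, conjTranspose_mul, conjTranspose_sub, conjTranspose_one,
      s.isHermitian.eq, (Φ a).isHermitian.eq, Herm.coe_compress, Herm.coe_compress]
    have h2 : (1 - (s : Matrix (Fin n) (Fin n) ℂ)) * (1 - s) = 1 - s := by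
      rw [sub_mul, mul_sub, mul_sub, hss]; simp
    rw [AddSubgroupClass.coe_sub, selfAdjoint.val_one]
    nth_rw 1 [← h2]
    simp only [mul_assoc]
  have h2 := hfaithful (s.compress ((Φ a).compress (1 - s)))
    (h1 ▸ posSemidef_conjTranspose_mul_self _) (by rw [h.map_compress hs, h0])
  have h3 : m = 0 := by
    rw [← trace_conjTranspose_mul_self_eq_zero_iff, ← h1]
    rw [Herm.coe_compress, ← mul_assoc, ← mul_assoc, hss, ← Herm.coe_compress] at h2
    rw [h2, trace_zero]
  rw [hm, sub_mul, sub_mul, one_mul, sub_eq_zero] at h3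
  have h4 := congrArg conjTranspose h3
  rw [conjTranspose_mul, conjTranspose_mul, conjTranspose_mul, s.isHermitian.eq,
    (Φ a).isHermitian.eq, ← mul_assoc] at h4
  exact h4.trans h3.symm

/-- For `a = b` the difference is positive by Kadison's inequality and killed by `T`, hence killed
by `s`; polarization gives the general case. -/
lemma support_mul_map (h : IsPositiveRetraction Φ T f ρ)
    (hfaithful : ∀ x : Herm n, (x : Matrix (Fin n) (Fin n) ℂ).PosSemidef → T x = 0 →
      (s : Matrix (Fin n) (Fin n) ℂ) * x = 0) (a b : A) :
    (s : Matrix (Fin n) (Fin n) ℂ) * Φ (T (Herm.jordanMul (Φ a) (Φ b))) =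
      s * Herm.jordanMul (Φ a) (Φ b) := by
  let D : Herm n →ₗ[ℝ] Matrix (Fin n) (Fin n) ℂ :=
    LinearMap.mulLeft ℝ (s : Matrix (Fin n) (Fin n) ℂ) ∘ₗ
      (selfAdjoint.submodule ℝ _).subtype ∘ₗ (Φ ∘ₗ T - LinearMap.id)
  have hD (x : Herm n) : D x = s * (Φ (T x) - x : Herm n) := rfl
  have hsq (a : A) : D (Herm.jordanMul (Φ a) (Φ a)) = 0 := by
    rw [hD]
    have := h.kadison (Φ a)
    rw [h.leftInverse] at this
    exact hfaithful _ this (by rw [map_sub, h.leftInverse, sub_self])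
  have hpol : Herm.jordanMul (Φ a) (Φ b) = (1 / 2 : ℝ) • (Herm.jordanMul (Φ (a + b)) (Φ (a + b)) -
      Herm.jordanMul (Φ a) (Φ a) - Herm.jordanMul (Φ b) (Φ b)) := by
    simp only [← Herm.jordan_apply, map_add, LinearMap.add_apply]
    rw [Herm.jordan_apply (Φ b) (Φ a), Herm.jordanMul_comm, ← Herm.jordan_apply]
    module
  have h0 : D (Herm.jordanMul (Φ a) (Φ b)) = 0 := by
    rw [hpol, map_smul, map_sub, map_sub, hsq, hsq, hsq]; simp
  rw [hD, AddSubgroupClass.coe_sub, mul_sub, sub_eq_zero] at h0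
  exact h0

/-- The range of a positive contractive projection, cut down to its support, is a unital Jordan
algebra of Hermitian matrices. -/
lemma exists_jordan_compression [Finite ι] (h : IsPositiveRetraction Φ T f ρ) :
    ∃ s : Herm n, (1 - (s : Matrix (Fin n) (Fin n) ℂ)).PosSemidef ∧
      (∀ x, T (s.compress x) = T x) ∧ s.compress (Φ (T 1)) = s ∧
      (∀ a, Herm.jordanMul s (s.compress (Φ a)) = s.compress (Φ a)) ∧
      ∀ a b, Herm.jordanMul (s.compress (Φ a)) (s.compress (Φ b)) =
        s.compress (Φ (T (Herm.jordanMul (Φ a) (Φ b)))) := by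
  obtain ⟨s, hss, hs, hf⟩ := h.exists_support
  have hc (a : A) : (s.compress (Φ a) : Matrix (Fin n) (Fin n) ℂ) = s * Φ a := by
    rw [Herm.coe_compress, mul_assoc, ← h.commute hss hs hf, ← mul_assoc, hss]
  refine ⟨s, by simpa using Herm.one_sub_posSemidef hss, h.map_compress hs, ?_, fun a => ?_,
    fun a b => ?_⟩
  · ext1
    rw [hc]
    have := hf (1 - Φ (T 1)) (by simpa using h.posSemidef_one_sub)
      (by rw [map_sub, h.leftInverse, sub_self])
    rw [AddSubgroupClass.coe_sub, mul_sub, selfAdjoint.val_one, mul_one, sub_eq_zero] at this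
    exact this.symm
  · ext1
    have h1 : (s : Matrix (Fin n) (Fin n) ℂ) * s.compress (Φ a) = s.compress (Φ a) := by
      rw [Herm.coe_compress, ← mul_assoc, ← mul_assoc, hss]
    have h2 : (s.compress (Φ a) : Matrix (Fin n) (Fin n) ℂ) * s = s.compress (Φ a) := by
      rw [Herm.coe_compress, mul_assoc, hss]
    rw [Herm.coe_jordanMul, h1, h2, ← two_smul ℝ, smul_smul]
    norm_num
  · ext1
    have hmul (a b : A) : (s : Matrix (Fin n) (Fin n) ℂ) * Φ a * (s * Φ b) = s * (Φ a * Φ b) := by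
      rw [h.commute hss hs hf b, ← mul_assoc, mul_assoc _ (Φ a : Matrix (Fin n) (Fin n) ℂ),
        mul_assoc, mul_assoc, ← h.commute hss hs hf b, ← mul_assoc (Φ a : Matrix (Fin n) (Fin n) ℂ),
        ← h.commute hss hs hf a, mul_assoc, ← mul_assoc _ _ (_ * _), hss]
    rw [hc, h.support_mul_map hf, Herm.coe_jordanMul, hc, hc, hmul, hmul, Herm.coe_jordanMul,
      mul_smul_comm, mul_add]

end IsPositiveRetraction

/-! ### The Jordan algebra of an exactly embedded theory -/

/-- A subspace of Hermitian matrices that is closed under the Jordan product and has a unit for it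
is a commutative nonassociative ring. -/
abbrev Herm.jordanRing {n : ℕ} (S : Submodule ℝ (Herm n))
    (hS : ∀ x ∈ S, ∀ y ∈ S, jordanMul x y ∈ S) (s : S) (hs : ∀ x ∈ S, jordanMul s x = x) :
    NonAssocCommRing S where
  __ := (inferInstance : AddCommGroup S)
  mul x y := ⟨jordanMul x y, hS _ x.2 _ y.2⟩
  one := s
  left_distrib x y z := Subtype.ext ((jordan n x).map_add y z)
  right_distrib x y z := Subtype.ext (LinearMap.map_add₂ (jordan n) _ _ _)
  zero_mul x := Subtype.ext (LinearMap.map_zero₂ (jordan n) _)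
  mul_zero x := Subtype.ext ((jordan n x).map_zero)
  mul_comm x y := Subtype.ext (jordanMul_comm _ _)
  one_mul x := Subtype.ext (hs _ x.2)
  mul_one x := Subtype.ext ((jordanMul_comm _ _).trans (hs _ x.2))

lemma Herm.jordan_identity {n : ℕ} (a b : Herm n) :
    jordanMul (jordanMul a b) (jordanMul a a) = jordanMul a (jordanMul b (jordanMul a a)) := by
  ext1
  simp only [coe_jordanMul, mul_smul_comm, smul_mul_assoc, ← smul_add]
  congr 2
  noncomm_ring

/-- An unrestricted theory that embeds exactly into quantum theory is the theory of a special
Euclidean Jordan algebra. -/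
theorem GPTData.IsGPT.isSpecialEuclideanJordanGPT {A : Type*} [AddCommGroup A] [Module ℝ A]
    {𝒜 : GPTData A} (h𝒜 : 𝒜.IsGPT) (hu : 𝒜.IsUnrestricted) {n : ℕ}
    (h : 𝒜.ExactlyEmbeds (quantumGPT n)) : IsSpecialEuclideanJordanGPT 𝒜 := by
  obtain ⟨Φ, Ψ, hΦ, hΨ, hΦΨ⟩ := h
  have := h𝒜.finiteDimensional
  -- The dual of `Ψ` is a left inverse of `Φ`.
  let T : Herm n →ₗ[ℝ] A := (Module.evalEquiv ℝ A).symm.toLinearMap ∘ₗ Ψ.dualMap ∘ₗ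
    Module.Dual.eval ℝ (Herm n)
  have hT (ω : Module.Dual ℝ A) (x : Herm n) : ω (T x) = Ψ ω x := by
    simp [T]
  have hsep {a b : A} (hab : ∀ ω ∈ 𝒜.states, ω a = ω b) : a = b := by
    rw [← sub_eq_zero, ← Module.forall_dual_apply_eq_zero_iff ℝ]
    intro ω
    have hω : ω ∈ Submodule.span ℝ 𝒜.states := h𝒜.span_states ▸ Submodule.mem_top
    induction hω using Submodule.span_induction with
    | mem ω hω => rw [map_sub, hab ω hω, sub_self]
    | zero => simp
    | add x y _ _ hx hy => rw [LinearMap.add_apply, hx, hy, add_zero]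
    | smul c x _ hx => rw [LinearMap.smul_apply, hx, smul_zero]
  have hρ (ω : Module.Dual ℝ A) (hω : ω ∈ 𝒜.states) : ∃ ρ : Herm n,
      (ρ : Matrix (Fin n) (Fin n) ℂ).PosSemidef ∧ Herm.traceForm n ρ (1 : Herm n) = 1 ∧
      ∀ x : Herm n, ω (T x) = Herm.traceForm n ρ x := by
    obtain ⟨ρ, hρ, h1, h⟩ := hΨ ω hω
    refine ⟨⟨ρ, hρ.1⟩, hρ, ?_, fun x => ?_⟩
    · rw [Herm.traceForm_apply, selfAdjoint.val_one, mul_one, h1, Complex.one_re]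
    · rw [hT, Herm.traceForm_apply, ← h, Complex.ofReal_re]
  have hTΦ (a : A) : T (Φ a) = a := by
    have ha : a ∈ Submodule.span ℝ 𝒜.effects := h𝒜.span_effects ▸ Submodule.mem_top
    induction ha using Submodule.span_induction with
    | mem e he => exact hsep fun ω hω => by rw [hT, hΦΨ e he ω hω]
    | zero => simp
    | add x y _ _ hx hy => rw [map_add, map_add, hx, hy]
    | smul c x _ hx => rw [map_smul, map_smul, hx]
  have hT1 : T 1 = 𝒜.unit := hsep fun ω hω => by
    obtain ⟨ρ, -, h1, h⟩ := hρ ω hω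
    rw [h, h1, h𝒜.apply_unit ω hω]
  have hTe (x : Herm n) (hx : x ∈ (quantumGPT n).effects) : T x ∈ 𝒜.effects := by
    rw [hu.effects_eq]
    intro ω hω
    obtain ⟨ρ, hρ, h1, h⟩ := hρ ω hω
    rw [h]
    refine ⟨hρ.traceForm_nonneg hx.1, ?_⟩
    have := hρ.traceForm_nonneg hx.2
    rw [map_sub] at this
    exact (sub_nonneg.1 this).trans_eq h1
  have hTnonneg (ω : Module.Dual ℝ A) (hω : ω ∈ 𝒜.states) (x : Herm n)
      (hx : (x : Matrix (Fin n) (Fin n) ℂ).PosSemidef) : 0 ≤ ω (T x) := by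
    obtain ⟨ρ, hρ, -, h⟩ := hρ ω hω
    rw [h]
    exact hρ.traceForm_nonneg hx
  -- Finitely many states already separate points, and finiteness lets the joint support be that of
  -- a sum of density matrices.
  obtain ⟨t, hts, -, htspan, -⟩ := Submodule.exists_finset_span_eq_linearIndepOn ℝ 𝒜.states
  choose! ρ hρpos _ hρT using hρ
  have hret : IsPositiveRetraction (ι := t) Φ T (fun ω => ω) (fun ω => ρ ω) :=
    { leftInverse := hTΦ
      posSemidef_map := fun x hx => (hΦ _ (hTe x hx)).1
      posSemidef_one_sub := by rw [hT1]; exact (hΦ _ h𝒜.unit_mem).2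
      separating := fun a ha => by
        rw [← Module.forall_dual_apply_eq_zero_iff ℝ]
        intro ω
        have hω : ω ∈ Submodule.span ℝ (t : Set (Module.Dual ℝ A)) := by
          rw [htspan, h𝒜.span_states]; exact Submodule.mem_top
        induction hω using Submodule.span_induction with
        | mem ω hω => exact ha ⟨ω, hω⟩
        | zero => simp
        | add x y _ _ hx hy => rw [LinearMap.add_apply, hx, hy, add_zero]
        | smul c x _ hx => rw [LinearMap.smul_apply, hx, smul_zero]
      apply_map := fun i x => hρT _ (hts i.2) x
      posSemidef_density := fun i => hρpos _ (hts i.2) }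
  obtain ⟨s, hs1, hTs, hsΦ, hsmul, hmul⟩ := hret.exists_jordan_compression
  let g : A →ₗ[ℝ] Herm n := s.compress ∘ₗ Φ
  have hTg (a : A) : T (g a) = a := (hTs _).trans (hTΦ a)
  let S : Submodule ℝ (Herm n) := LinearMap.range g
  let F : A ≃ₗ[ℝ] S := LinearEquiv.ofInjective g (Function.LeftInverse.injective hTg)
  have hF (a : A) : (F a : Herm n) = s.compress (Φ a) := rfl
  have hTF (x : S) : T x = F.symm x := by
    obtain ⟨a, rfl⟩ := F.surjective x
    rw [F.symm_apply_apply]; exact hTg a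
  have hclosed : ∀ x ∈ S, ∀ y ∈ S, Herm.jordanMul x y ∈ S := by
    rintro _ ⟨a, rfl⟩ _ ⟨b, rfl⟩
    exact ⟨_, (hmul a b).symm⟩
  let sS : S := ⟨s, T 1, hsΦ⟩
  have hunit : ∀ x ∈ S, Herm.jordanMul sS x = x := by
    rintro _ ⟨a, rfl⟩
    exact hsmul a
  let _ : NonAssocCommRing S := Herm.jordanRing S hclosed sS hunit
  have hφ : IsJordanEmbedding S.subtype := ⟨S.injective_subtype, fun _ _ => rfl⟩
  have hβ := hφ.isEuclideanForm
  have hFe {e : A} (he : e ∈ 𝒜.effects) : F e ∈ squareCone S := by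
    rw [hφ.mem_squareCone_iff]
    have := (hΦ e he).1.mul_mul_conjTranspose_same (s : Matrix (Fin n) (Fin n) ℂ)
    rwa [s.isHermitian.eq] at this
  have hFu : F 𝒜.unit = 1 := Subtype.ext (by rw [hF, ← hT1, hsΦ]; rfl)
  have hFe1 {e : A} (he : e ∈ 𝒜.effects) : 1 - F e ∈ squareCone S := by
    rw [← hFu, ← map_sub]
    exact hFe (h𝒜.unit_sub_mem e he)
  have hsc : SMulCommClass ℝ S S :=
    ⟨fun c x y => Subtype.ext (((Herm.jordan n x).map_smul c y).symm)⟩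
  have hst : IsScalarTower ℝ S S :=
    ⟨fun c x y => Subtype.ext (LinearMap.map_smul₂ (Herm.jordan n) c _ _)⟩
  refine ⟨S, inferInstance, inferInstance, hsc, hst, inferInstance,
    ⟨fun a b => Subtype.ext (Herm.jordan_identity _ _)⟩, Herm.pullbackTraceForm S.subtype, hβ,
    ⟨n, S.subtype, hφ.injective, hφ.map_mul⟩, F, ?_, hFu, ?_⟩
  · ext x
    rw [hβ.mem_effects_iff hφ]
    constructor
    · rintro ⟨e, he, rfl⟩
      exact ⟨hFe he, hFe1 he⟩
    · rintro ⟨h0, h1⟩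
      refine ⟨F.symm x, ?_, F.apply_symm_apply x⟩
      rw [← hTF]
      refine hTe _ ⟨hφ.mem_squareCone_iff.1 h0, ?_⟩
      -- The unit of `S` is `s`, so `1 - x = (1 - s) + (s - x)` as matrices, and both terms are
      -- positive.
      have := hs1.add (hφ.mem_squareCone_iff.1 h1)
      have h2 : S.subtype (1 - x) = s - x := rfl
      rw [h2] at this
      simpa using this
  · ext ω
    constructor
    · intro hω
      -- The state is represented through the trace form; it is nonnegative on squares because `T`
      -- agrees with the inverse of `F` on `S`.
      obtain ⟨w, hw⟩ := (LinearMap.BilinForm.toDual _ hβ.nondegenerate).surjective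
        (ω ∘ₗ F.symm.toLinearMap)
      have hw' : Herm.pullbackTraceForm S.subtype w = ω ∘ₗ F.symm.toLinearMap := by
        rw [← hw]; rfl
      refine ⟨_, ⟨w, hβ.mem_squareCone hφ fun y => ?_, ?_, hw'.symm⟩, ?_⟩
      · rw [hβ.symm, hw']
        change 0 ≤ ω (F.symm (y * y))
        rw [← hTF]
        exact hTnonneg ω hω _ (hφ.mem_squareCone_iff.1 ⟨y, rfl⟩)
      · rw [hw', ← hFu]
        simp [h𝒜.apply_unit ω hω]
      · ext a; simp
    · rintro ⟨_, ⟨w, ⟨y, rfl⟩, hw1, rfl⟩, rfl⟩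
      rw [hu.states_eq]
      refine ⟨?_, fun e he => ?_⟩
      · simp [hFu, hw1]
      · exact ((hβ.mem_effects_iff hφ).2 ⟨hFe he, hFe1 he⟩).2 _ ⟨y, rfl⟩ hw1

end

theorem theorem2 {A : Type*} [AddCommGroup A] [Module ℝ A] (𝒜 : GPTData A)
    (h𝒜 : 𝒜.IsGPT) (hu : 𝒜.IsUnrestricted) :
    (∃ n : ℕ, 𝒜.ExactlyEmbeds (quantumGPT n)) ↔ IsSpecialEuclideanJordanGPT 𝒜 :=
  ⟨fun ⟨_, h⟩ => h𝒜.isSpecialEuclideanJordanGPT hu h, fun h => h.exactlyEmbeds⟩
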